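/- **Setting.** There are $n$ individuals and a finite data universe $N$. A database is $v=(v^1,\dots,v^n)\in N^n$, where $v^i$ is the record of individual $i$. For $x\in N$ let $v_x=|\{i : v^i=x\}|$, and let $fhh(v)=\max_{x\in N}v_x$ be the frequency of the heavy hitter. An *algorithm in the local model* draws private-data-independent coins and then makes a finite number of oracle calls. In each call it chooses, depending on its coins and on all earlier answers, an individual $i$ and a randomizer (a randomized map from $N$ to a space of messages); the answer is the output of this randomizer, run with fresh randomness on $v^i$ alone. At the end it outputs an element $A(v)\in N$, computed (possibly with further randomness) from its coins and the answers only. The message and coin spaces are arbitrary measurable spaces, the number of calls is arbitrary, and an individual may be queried several times. The algorithm is *$(\epsilon,\delta)$-private* if for every individual $i$, all fixed records of the other individuals, all $x,x'\in N$ and every event $S$ about the transcript (the coins together with all answers), $$\Pr[\text{transcript}\in S\mid v^i=x]\le e^{\epsilon}\,\Pr[\text{transcript}\in S\mid v^i=x']+\delta .$$ The algorithm is *$(\alpha,\beta)$-accurate for heavy hitters* if for every database $v\in N^n$, with probability at least $1-\beta$, $v_{A(v)}\ge fhh(v)-\alpha$. **Theorem.** For every $\delta_0<1$ there are constants $c>0$,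 $\beta>0$ and $n_0\in\mathbb N$, depending only on $\delta_0$, such that for all $\epsilon\le 1/2$, all $\delta\le\delta_0$, all $n\ge n_0$ and every finite universe $N$ with $|N|\ge 2$ (in particular for $|N|=2$), no $(\epsilon,\delta)$-private algorithm in the local model with $n$ individuals and universe $N$ is $(c\sqrt n,\beta)$-accurate for heavy hitters. -/

import Mathlib

open MeasureTheory ProbabilityTheory

noncomputable section

namespace LocalPrivacy

/-- The number of occurrences of the universe element `x` in the database `v`, in which
individual `i` holds the record `v i` (the histogram of `v` at `x`). -/
def count {n : ℕ} {N : Type*} [DecidableEq N] (v : Fin n → N) (x : N) : ℕ :=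
  (Finset.univ.filter fun i => v i = x).card

/-- The frequency of the heavy hitter: the largest number of occurrences of an element. -/
def fhh {n : ℕ} {N : Type*} [Fintype N] [DecidableEq N] (v : Fin n → N) : ℕ :=
  Finset.univ.sup (count v)

/-- `(ε, δ)`-differential privacy of a randomized map `P` of one individual's record:
the output laws on any two possible records satisfy the usual inequality on all events. -/
def IsDP {N R : Type*} [MeasurableSpace R] (ε δ : ℝ) (P : N → Measure R) : Prop :=
  ∀ x x' : N, ∀ S : Set R, MeasurableSet S →
    (P x).real S ≤ Real.exp ε * (P x').real S + δ

/-- A transcript after `t` oracle calls: the coins of the algorithm and the `t` answers. -/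
abbrev Transcript (Ω M : Type*) (t : ℕ) : Type _ := Ω × (Fin t → M)

/-- An (adaptive, interactive) algorithm in the local model with `n` individuals, universe `N`,
space of coins `Ω` and space of messages `M`. It draws its coins, and then makes `rounds` calls
to the oracle. The call number `t` names an individual and a randomizer, both of which may
depend on the coins and on all earlier answers. The individual named applies the
randomizer, with fresh randomness, to her own record, and the result is the answer. In the end
the algorithm outputs an element of `N`, possibly with further randomization, from the coins and
the answers alone. -/
structure LocalAlgorithm (n : ℕ) (N Ω M : Type*)
    [MeasurableSpace N] [MeasurableSpace Ω] [MeasurableSpace M] where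
  /-- the law of the coins -/
  coins : Measure Ω
  isProbabilityMeasure_coins : IsProbabilityMeasure coins
  /-- the number of oracle calls -/
  rounds : ℕ
  /-- the individual who is queried -/
  user : (t : ℕ) → Transcript Ω M t → Fin n
  measurable_user : ∀ t, Measurable (user t)
  /-- `randomizer t x h` is the law of the answer to call `t` after the transcript `h`, if the
  record of the individual queried is `x` -/
  randomizer : (t : ℕ) → N → Kernel (Transcript Ω M t) M
  isMarkovKernel_randomizer : ∀ t x, IsMarkovKernel (randomizer t x)
  /-- the output as a function of the final transcript -/
  output : Kernel (Transcript Ω M rounds) N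
  isMarkovKernel_output : IsMarkovKernel output

namespace LocalAlgorithm

variable {n : ℕ} {N Ω M : Type*} [MeasurableSpace N] [MeasurableSpace Ω] [MeasurableSpace M]

attribute [instance] isProbabilityMeasure_coins isMarkovKernel_randomizer isMarkovKernel_output

/-- The law of the answer to call `t` on the database `v`, given the earlier transcript. -/
def answer (A : LocalAlgorithm n N Ω M) (v : Fin n → N) (t : ℕ) :
    Kernel (Transcript Ω M t) M where
  toFun h := A.randomizer t (v (A.user t h)) h
  measurable' := by
    have h1 : Measurable fun p : Fin n × Transcript Ω M t => A.randomizer t (v p.1) p.2 :=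
      measurable_from_prod_countable_right fun i => (A.randomizer t (v i)).measurable
    exact h1.comp ((A.measurable_user t).prodMk measurable_id)

instance (A : LocalAlgorithm n N Ω M) (v : Fin n → N) (t : ℕ) :
    IsMarkovKernel (A.answer v t) :=
  ⟨fun h => (A.isMarkovKernel_randomizer t (v (A.user t h))).isProbabilityMeasure h⟩

/-- Appending an answer to a transcript. -/
def extend (Ω M : Type*) (t : ℕ) (p : Transcript Ω M t × M) : Transcript Ω M (t + 1) :=
  (p.1.1, Fin.snoc (α := fun _ => M) p.1.2 p.2)

theorem measurable_extend (t : ℕ) : Measurable (extend Ω M t) := by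
  refine Measurable.prodMk (measurable_fst.comp measurable_fst) ?_
  refine measurable_pi_lambda _ fun i => ?_
  refine Fin.lastCases ?_ (fun j => ?_) i
  · simpa [Fin.snoc_last] using measurable_snd
  · simp only [Fin.snoc_castSucc]
    exact (measurable_pi_apply j).comp (measurable_snd.comp measurable_fst)

/-- The law of the transcript of the first `t` oracle calls on the database `v`. -/
def transcriptLaw (A : LocalAlgorithm n N Ω M) (v : Fin n → N) :
    (t : ℕ) → Measure (Transcript Ω M t)
  | 0 => A.coins.map fun ω => (ω, Fin.elim0)
  | t + 1 => ((A.transcriptLaw v t) ⊗ₘ (A.answer v t)).map (extend Ω M t)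

instance (A : LocalAlgorithm n N Ω M) (v : Fin n → N) (t : ℕ) :
    IsProbabilityMeasure (A.transcriptLaw v t) := by
  induction t with
  | zero =>
    exact Measure.isProbabilityMeasure_map
      (measurable_id.prodMk measurable_const).aemeasurable
  | succ t ih => exact Measure.isProbabilityMeasure_map (measurable_extend t).aemeasurable

/-- The law of the output on the database `v`. -/
def outputLaw (A : LocalAlgorithm n N Ω M) (v : Fin n → N) : Measure N :=
  (A.transcriptLaw v A.rounds).bind A.output

/-- `(ε, δ)`-privacy in the local model: for every individual `i`, whatever the records of the
others, the joint law of everything the algorithm sees (its coins and all the answers, those of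
`i` included) is an `(ε, δ)`-differentially private function of the record of `i`. -/
def IsPrivate (A : LocalAlgorithm n N Ω M) (ε δ : ℝ) : Prop :=
  ∀ (i : Fin n) (v : Fin n → N),
    IsDP ε δ fun x : N => A.transcriptLaw (Function.update v i x) A.rounds

/-- `(α, β)`-accuracy for the heavy hitters problem: on every database, with probability at least
`1 - β`, the output occurs at least `fhh v - α` times. -/
def IsAccurate [Fintype N] [DecidableEq N] (A : LocalAlgorithm n N Ω M) (α β : ℝ) : Prop :=
  ∀ v : Fin n → N, 1 - β ≤ (A.outputLaw v).real {x | (fhh v : ℝ) - α ≤ (count v x : ℝ)}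

end LocalAlgorithm

end LocalPrivacy

end

/-! Fix two records and let every individual hold one of them according to an independent fair bit.
Each answer depends on the record of a single individual, so the density of the transcript is a
product of factors, one per individual. Hence the bits remain independent given the transcript, with
posterior probabilities `θ i` (`exists_transcriptLaw_eq_withDensity`, `exists_posterior`).

Privacy keeps a transcript from revealing a bit too reliably, so the expected posterior variance of
each bit is bounded below (`le_integral_variance`), and with constant probability the posterior
variance of the count is of order `n` (`le_measureReal_variance_large`). The posterior mean of the
count is usually within `O(√n)` of `n / 2` (`measureReal_mean_far_le`).

For a transcript with both properties, anticoncentration (`le_bernProd_tail`) gives constant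
posterior mass both to counts below `n / 2 - √n` and to counts above `n / 2 + √n`. These cases
require different outputs, while the output law depends on the transcript only. So the failure
probability, averaged over databases, is at least a constant (`le_sum_bernProd_mul_failure`). -/

open scoped ENNReal NNReal

namespace LocalPrivacy

/-! ### Tails of sums of independent, non-identical bits. -/

/-- The weight which the Bernoulli law with parameter `p` gives to a bit. -/
def bernWeight (p : ℝ) (b : Bool) : ℝ := bif b then p else 1 - p

/-- The weight of a vector of bits under the product of Bernoulli laws. -/
def bernProd {n : ℕ} (θ : Fin n → ℝ) (v : Fin n → Bool) : ℝ := ∏ i, bernWeight (θ i) (v i)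

/-- The number of bits of a vector which are `true`, as a real number. -/
def trueCount {n : ℕ} (v : Fin n → Bool) : ℝ := ∑ i, bif v i then 1 else 0

theorem sum_prod_bool {n : ℕ} (f : Fin n → Bool → ℝ) :
    ∑ v : Fin n → Bool, ∏ i, f i (v i) = ∏ i, (f i true + f i false) := by
  have h := Finset.prod_univ_sum (fun _ : Fin n => (Finset.univ : Finset Bool)) f
  rw [Fintype.piFinset_univ] at h
  rw [← h]
  simp

theorem bernWeight_nonneg {p : ℝ} (h0 : 0 ≤ p) (h1 : p ≤ 1) (b : Bool) : 0 ≤ bernWeight p b := by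
  cases b <;> simp [bernWeight, h0, h1]

theorem bernWeight_le_one {p : ℝ} (h0 : 0 ≤ p) (h1 : p ≤ 1) (b : Bool) : bernWeight p b ≤ 1 := by
  cases b <;> simp [bernWeight, h0, h1]

theorem bernProd_nonneg {n : ℕ} {θ : Fin n → ℝ} (h0 : ∀ i, 0 ≤ θ i) (h1 : ∀ i, θ i ≤ 1)
    (v : Fin n → Bool) : 0 ≤ bernProd θ v :=
  Finset.prod_nonneg fun i _ => bernWeight_nonneg (h0 i) (h1 i) _

theorem bernProd_le_one {n : ℕ} {θ : Fin n → ℝ} (h0 : ∀ i, 0 ≤ θ i) (h1 : ∀ i, θ i ≤ 1)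
    (v : Fin n → Bool) : bernProd θ v ≤ 1 :=
  Finset.prod_le_one (fun i _ => bernWeight_nonneg (h0 i) (h1 i) _)
    fun i _ => bernWeight_le_one (h0 i) (h1 i) _

theorem sum_bernProd {n : ℕ} (θ : Fin n → ℝ) : ∑ v, bernProd θ v = 1 := by
  unfold bernProd
  rw [sum_prod_bool]
  simp [bernWeight]

/-- The exponential moment factorises. By `exp y ≤ 1 + y + y ^ 2` for `|y| ≤ 1`, and since the
centred linear term averages to zero, each factor is at most `1 + 1 / n`. -/
theorem sum_bernProd_exp_le {n : ℕ} (hn : 0 < n) {θ : Fin n → ℝ} (h0 : ∀ i, 0 ≤ θ i)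
    (h1 : ∀ i, θ i ≤ 1) {σ : ℝ} (hσ : |σ| ≤ 1) :
    ∑ v, bernProd θ v * Real.exp (σ * (trueCount v - ∑ i, θ i) / √n) ≤ Real.exp 1 := by
  have hs : 1 ≤ √(n : ℝ) := Real.one_le_sqrt.2 (by exact_mod_cast hn)
  have hs0 : 0 < √(n : ℝ) := by linarith
  have hsq : √(n : ℝ) ^ 2 = n := Real.sq_sqrt (by positivity)
  have key : ∀ v : Fin n → Bool,
      bernProd θ v * Real.exp (σ * (trueCount v - ∑ i, θ i) / √n)
        = ∏ i, (bernWeight (θ i) (v i)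
            * Real.exp (σ * ((bif v i then 1 else 0) - θ i) / √n)) := by
    intro v
    rw [Finset.prod_mul_distrib, ← Real.exp_sum, bernProd, trueCount, ← Finset.sum_div,
      ← Finset.mul_sum, Finset.sum_sub_distrib]
  simp_rw [key]
  rw [sum_prod_bool fun i b => bernWeight (θ i) b
            * Real.exp (σ * ((bif b then 1 else 0) - θ i) / √n)]
  have hexp : ∀ y : ℝ, |y| ≤ 1 → Real.exp (σ * y / √n) ≤ 1 + σ * y / √n + 1 / n := by
    intro y hy
    have hσy : |σ * y| ≤ 1 := by
      rw [abs_mul]; exact mul_le_one₀ hσ (abs_nonneg _) hy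
    have h2 : |σ * y / √n| ≤ 1 := by
      rw [abs_div, abs_of_pos hs0]
      exact (div_le_one hs0).2 (hσy.trans hs)
    have h3 := (abs_le.1 (Real.abs_exp_sub_one_sub_id_le h2)).2
    have h4 : (σ * y / √n) ^ 2 ≤ 1 / n := by
      rw [div_pow, hsq]
      have := sq_le_one_iff_abs_le_one (σ * y) |>.2 hσy
      gcongr
    linarith
  have hfac : ∀ i, bernWeight (θ i) true * Real.exp (σ * ((bif true then 1 else 0) - θ i) / √n)
      + bernWeight (θ i) false * Real.exp (σ * ((bif false then 1 else 0) - θ i) / √n)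
        ≤ Real.exp (1 / n) := by
    intro i
    have ha := hexp (1 - θ i) (abs_le.2 ⟨by linarith [h1 i], by linarith [h0 i]⟩)
    have hb := hexp (0 - θ i) (abs_le.2 ⟨by linarith [h1 i], by linarith [h0 i]⟩)
    have ha' := mul_le_mul_of_nonneg_left ha (h0 i)
    have hb' := mul_le_mul_of_nonneg_left hb (sub_nonneg.2 (h1 i))
    simp only [bernWeight, cond_true, cond_false]
    calc _ ≤ _ := add_le_add ha' hb'
      _ = 1 / n + 1 := by ring
      _ ≤ _ := Real.add_one_le_exp _
  calc _ ≤ ∏ _i : Fin n, Real.exp (1 / n) := by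
        refine Finset.prod_le_prod (fun i _ => ?_) fun i _ => hfac i
        have := bernWeight_nonneg (h0 i) (h1 i)
        have h1 := this true
        have h2 := this false
        positivity
    _ = Real.exp 1 := by
        rw [Finset.prod_const, ← Real.exp_nat_mul]
        simp [mul_inv_cancel₀ (Nat.cast_ne_zero.2 hn.ne' : (n : ℝ) ≠ 0)]

/-- An exponential tail bound for the number of ones under a product of Bernoulli laws. -/
theorem bernProd_tail_le {n : ℕ} (hn : 0 < n) {θ : Fin n → ℝ} (h0 : ∀ i, 0 ≤ θ i)
    (h1 : ∀ i, θ i ≤ 1) {σ : ℝ} (hσ : |σ| ≤ 1) (r : ℝ) :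
    ∑ v with r * √n ≤ σ * (trueCount v - ∑ i, θ i), bernProd θ v ≤ Real.exp (1 - r) := by
  have hs0 : 0 < √(n : ℝ) := Real.sqrt_pos.2 (by exact_mod_cast hn)
  calc _ ≤ ∑ v with r * √n ≤ σ * (trueCount v - ∑ i, θ i),
        bernProd θ v * Real.exp (σ * (trueCount v - ∑ i, θ i) / √n) * Real.exp (-r) := by
        refine Finset.sum_le_sum fun v hv => ?_
        rw [mul_assoc, ← Real.exp_add]
        refine le_mul_of_one_le_right (bernProd_nonneg h0 h1 v) (Real.one_le_exp ?_)
        have := (le_div_iff₀ hs0).2 (Finset.mem_filter.1 hv).2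
        linarith
    _ ≤ ∑ v, bernProd θ v * Real.exp (σ * (trueCount v - ∑ i, θ i) / √n) * Real.exp (-r) :=
        Finset.sum_le_sum_of_subset_of_nonneg (Finset.filter_subset _ _) fun v _ _ =>
          mul_nonneg (mul_nonneg (bernProd_nonneg h0 h1 v) (Real.exp_pos _).le) (Real.exp_pos _).le
    _ ≤ Real.exp 1 * Real.exp (-r) := by
        rw [← Finset.sum_mul]
        exact mul_le_mul_of_nonneg_right (sum_bernProd_exp_le hn h0 h1 hσ) (Real.exp_pos _).le
    _ = _ := by rw [← Real.exp_add, sub_eq_add_neg]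

/-- The complementary tail has mass at most `exp (-1) ≤ 1 / 2`. -/
theorem half_le_bernProd_near_mean {n : ℕ} (hn : 0 < n) {θ : Fin n → ℝ} (h0 : ∀ i, 0 ≤ θ i)
    (h1 : ∀ i, θ i ≤ 1) {σ : ℝ} (hσ : |σ| ≤ 1) :
    1 / 2 ≤ ∑ v with σ * (trueCount v - ∑ i, θ i) < 2 * √n, bernProd θ v := by
  have h := bernProd_tail_le hn h0 h1 hσ 2
  have hsplit : ∑ v with 2 * √n ≤ σ * (trueCount v - ∑ i, θ i), bernProd θ v
      + ∑ v with σ * (trueCount v - ∑ i, θ i) < 2 * √n, bernProd θ v = 1 := by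
    rw [← sum_bernProd θ, ← Finset.sum_filter_add_sum_filter_not Finset.univ
      (fun v => 2 * √n ≤ σ * (trueCount v - ∑ i, θ i)) (bernProd θ)]
    simp only [not_le]
  have he : Real.exp (1 - 2) ≤ 1 / 2 := by
    rw [show (1 - 2 : ℝ) = -1 by norm_num, Real.exp_neg, one_div]
    gcongr
    linarith [Real.exp_one_gt_d9]
  have h' := h.trans he
  set X := ∑ v with 2 * √n ≤ σ * (trueCount v - ∑ i, θ i), bernProd θ v
  linarith

/-- A lower bound for the tails of the number of ones under a product of Bernoulli laws,
below the mean for `σ = 1` and above it for `σ = -1`. -/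
theorem le_bernProd_tail {n : ℕ} (hn : 0 < n) {θ : Fin n → ℝ} (h0 : ∀ i, 0 ≤ θ i)
    (h1 : ∀ i, θ i ≤ 1) {σ : ℝ} (hσ : σ ^ 2 = 1) {l : ℝ} (hl : 0 ≤ l) (hln : l ≤ √n) :
    Real.exp (-l ^ 2) / 4 ≤
      ∑ v with σ * (trueCount v - ∑ i, θ i)
        < 2 * √n - l * (∑ i, θ i * (1 - θ i)) / √n, bernProd θ v := by
  have hσ1 : |σ| ≤ 1 := (sq_le_one_iff_abs_le_one σ).1 hσ.le
  have hs0 : 0 < √(n : ℝ) := Real.sqrt_pos.2 (by exact_mod_cast hn)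
  have hsq : √(n : ℝ) ^ 2 = n := Real.sq_sqrt (by positivity)
  -- Change of measure: tilting each bit by `τ` times its variance moves the mean of the count by `l
  -- * (∑ i, θ i * (1 - θ i)) / √n` in the direction `-σ`. The hypothesis `l ≤ √n` gives `|τ| ≤ 1`,
  -- which keeps the tilted parameters in `[0, 1]`.
  set τ : ℝ := σ * (l / √n) with hτ
  have hl1 : l / √n ≤ 1 := (div_le_one hs0).2 hln
  have hl0 : 0 ≤ l / √n := by positivity
  have hτ1 : |τ| ≤ 1 := by
    rw [hτ, abs_mul, abs_of_nonneg hl0]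
    exact mul_le_one₀ hσ1 hl0 hl1
  have hτ2 : τ ^ 2 = l ^ 2 / n := by rw [hτ, mul_pow, hσ, div_pow, hsq, one_mul]
  obtain ⟨hτa, hτb⟩ := abs_le.1 hτ1
  set θ' : Fin n → ℝ := fun i => θ i - τ * (θ i * (1 - θ i)) with hθ'
  have h0' : ∀ i, 0 ≤ θ' i := fun i => by
    have : θ' i = θ i * (1 - τ * (1 - θ i)) := by simp only [hθ']; ring
    rw [this]
    refine mul_nonneg (h0 i) ?_
    nlinarith [h0 i, h1 i]
  have h1' : ∀ i, θ' i ≤ 1 := fun i => by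
    have : 1 - θ' i = (1 - θ i) * (1 + τ * θ i) := by simp only [hθ']; ring
    have h2 : 0 ≤ (1 - θ i) * (1 + τ * θ i) := by
      refine mul_nonneg (sub_nonneg.2 (h1 i)) ?_
      nlinarith [h0 i, h1 i]
    linarith
  set L : (Fin n → Bool) → ℝ := fun v => ∏ i, (1 - τ * ((bif v i then 1 else 0) - θ i)) with hL
  have hWL : ∀ v, bernProd θ' v = bernProd θ v * L v := by
    intro v
    rw [hL, bernProd, bernProd, ← Finset.prod_mul_distrib]
    refine Finset.prod_congr rfl fun i _ => ?_
    cases v i <;> simp only [bernWeight, hθ', cond_true, cond_false] <;> ring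
  -- The second moment of the likelihood ratio factorises, each factor being `1 + τ ^ 2 * θ i * (1 -
  -- θ i)`.
  have hL2 : ∑ v, bernProd θ v * L v ^ 2 ≤ Real.exp (l ^ 2) := by
    have : ∀ v : Fin n → Bool, bernProd θ v * L v ^ 2 = ∏ i, (bernWeight (θ i) (v i)
        * (1 - τ * ((bif v i then 1 else 0) - θ i)) ^ 2) := by
      intro v
      rw [hL, bernProd, ← Finset.prod_pow, ← Finset.prod_mul_distrib]
    simp_rw [this]
    rw [sum_prod_bool fun i b => bernWeight (θ i) b
        * (1 - τ * ((bif b then 1 else 0) - θ i)) ^ 2]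
    calc _ ≤ ∏ _i : Fin n, Real.exp (l ^ 2 / n) := by
          refine Finset.prod_le_prod (fun i _ => ?_) fun i _ => ?_
          · have := bernWeight_nonneg (h0 i) (h1 i)
            have h1 := this true
            have h2 := this false
            positivity
          · simp only [bernWeight, cond_true, cond_false]
            rw [← hτ2]
            calc _ = τ ^ 2 * (θ i * (1 - θ i)) + 1 := by ring
              _ ≤ τ ^ 2 * 1 + 1 := by
                  gcongr
                  nlinarith [h0 i, h1 i]
              _ ≤ _ := by simpa using Real.add_one_le_exp (τ ^ 2)
      _ = _ := by
          rw [Finset.prod_const, ← Real.exp_nat_mul]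
          congr 1
          have : (n : ℝ) ≠ 0 := Nat.cast_ne_zero.2 hn.ne'
          simp only [Finset.card_univ, Fintype.card_fin]
          field_simp
  have hhalf := half_le_bernProd_near_mean hn h0' h1' hσ1
  have hset : ∀ v : Fin n → Bool, (σ * (trueCount v - ∑ i, θ' i) < 2 * √n ↔
      σ * (trueCount v - ∑ i, θ i) < 2 * √n - l * (∑ i, θ i * (1 - θ i)) / √n) := by
    intro v
    have : σ * (trueCount v - ∑ i, θ' i) =
        σ * (trueCount v - ∑ i, θ i) + l * (∑ i, θ i * (1 - θ i)) / √n := by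
      simp only [hθ']
      rw [Finset.sum_sub_distrib, ← Finset.mul_sum, hτ]
      linear_combination (l * (∑ i, θ i * (1 - θ i)) / √n) * hσ
    rw [this, lt_sub_iff_add_lt]
  simp_rw [hset] at hhalf
  set B := Finset.univ.filter fun v : Fin n → Bool =>
    σ * (trueCount v - ∑ i, θ i) < 2 * √n - l * (∑ i, θ i * (1 - θ i)) / √n
  -- The event has mass at least `1 / 2` under the tilted law; Cauchy–Schwarz carries this back to
  -- the original law at the cost of the second moment of `L`.
  have hCS : (∑ v ∈ B, bernProd θ' v) ^ 2 ≤
      (∑ v ∈ B, bernProd θ v) * ∑ v ∈ B, bernProd θ v * L v ^ 2 := by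
    refine Finset.sum_sq_le_sum_mul_sum_of_sq_le_mul _ (fun v _ => bernProd_nonneg h0 h1 v)
      (fun v _ => mul_nonneg (bernProd_nonneg h0 h1 v) (sq_nonneg _)) fun v _ => ?_
    rw [hWL]
    exact le_of_eq (by ring)
  have hB0 : 0 ≤ ∑ v ∈ B, bernProd θ v := Finset.sum_nonneg fun v _ => bernProd_nonneg h0 h1 v
  have hB2 : ∑ v ∈ B, bernProd θ v * L v ^ 2 ≤ Real.exp (l ^ 2) :=
    (Finset.sum_le_sum_of_subset_of_nonneg (Finset.subset_univ _) fun v _ _ =>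
      mul_nonneg (bernProd_nonneg h0 h1 v) (sq_nonneg _)).trans hL2
  have h4 : 1 / 4 ≤ (∑ v ∈ B, bernProd θ v) * Real.exp (l ^ 2) := by
    have := mul_le_mul_of_nonneg_left hB2 hB0
    nlinarith
  rw [Real.exp_neg, div_le_iff₀ (by norm_num), inv_le_iff_one_le_mul₀ (Real.exp_pos _)]
  linarith

/-! ### Product form of the transcript density. -/

/-- Composition-products commute with densities in the first argument. -/
theorem compProd_withDensity_left {α β : Type*} [MeasurableSpace α] [MeasurableSpace β]
    (μ : Measure α) [IsFiniteMeasure μ] (κ : Kernel α β) [IsFiniteKernel κ] {g : α → ℝ≥0}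
    (hg : Measurable g) :
    (μ.withDensity fun x => g x) ⊗ₘ κ = (μ ⊗ₘ κ).withDensity fun p => g p.1 := by
  have hg' : Measurable fun p : α × β => (g p.1 : ℝ≥0∞) := by fun_prop
  ext s hs
  rw [Measure.compProd_apply hs, withDensity_apply _ hs, ← lintegral_indicator hs,
    Measure.lintegral_compProd (hg'.indicator hs),
    lintegral_withDensity_eq_lintegral_mul _ (by fun_prop)
      (Kernel.measurable_kernel_prodMk_left hs)]
  refine lintegral_congr fun a => ?_
  have : ∀ b, s.indicator (fun p : α × β => (g p.1 : ℝ≥0∞)) (a, b)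
      = (g a : ℝ≥0∞) * (Prod.mk a ⁻¹' s).indicator 1 b := by
    intro b
    by_cases h : (a, b) ∈ s <;> simp [h]
  simp_rw [this]
  rw [lintegral_const_mul _ (measurable_one.indicator (measurable_prodMk_left hs)),
    lintegral_indicator_one (measurable_prodMk_left hs)]
  rfl

/-- A kernel composed with a measure has a density with respect to any larger kernel composed
with the same measure. -/
theorem exists_compProd_eq_withDensity {α β : Type*} [MeasurableSpace α] [MeasurableSpace β]
    (μ : Measure α) [IsFiniteMeasure μ] (κ η : Kernel α β) [IsFiniteKernel κ] [IsFiniteKernel η] :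
    ∃ f : α × β → ℝ≥0, Measurable f ∧
      μ ⊗ₘ κ = (μ ⊗ₘ (κ + η)).withDensity fun p => f p := by
  -- Since `δ` may be positive, the answer laws for two records can be mutually singular; their sum
  -- dominates both. Differentiating the joint measures, not the kernels fibrewise, avoids
  -- countability assumptions on the message space.
  have hac : μ ⊗ₘ κ ≪ μ ⊗ₘ (κ + η) := by
    rw [Measure.compProd_add_right]
    exact Measure.AbsolutelyContinuous.rfl.add_right _
  refine ⟨fun p => ((μ ⊗ₘ κ).rnDeriv (μ ⊗ₘ (κ + η)) p).toNNReal,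
    (Measure.measurable_rnDeriv _ _).ennreal_toNNReal, ?_⟩
  conv_lhs => rw [← Measure.withDensity_rnDeriv_eq _ _ hac]
  refine withDensity_congr_ae ?_
  filter_upwards [Measure.rnDeriv_lt_top (μ ⊗ₘ κ) (μ ⊗ₘ (κ + η))] with p hp
  exact (ENNReal.coe_toNNReal hp.ne).symm

namespace LocalAlgorithm

variable {n : ℕ} {N Ω M : Type*} [MeasurableSpace N] [MeasurableSpace Ω] [MeasurableSpace M]

/-- The inverse of `extend`. -/
def unextend (Ω M : Type*) (t : ℕ) (p : Transcript Ω M (t + 1)) : Transcript Ω M t × M :=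
  ((p.1, fun i => p.2 i.castSucc), p.2 (Fin.last t))

theorem measurable_unextend (t : ℕ) : Measurable (unextend Ω M t) := by
  unfold unextend
  fun_prop

theorem unextend_extend {Ω M : Type*} (t : ℕ) (p : Transcript Ω M t × M) :
    unextend Ω M t (extend Ω M t p) = p := by
  simp [unextend, extend]

/-- The composition with the answers to a call has a density that depends on the database only
through the record of the individual queried. -/
theorem compProd_answer (A : LocalAlgorithm n N Ω M) (t : ℕ) (μ : Measure (Transcript Ω M t))
    [IsFiniteMeasure μ] (ρ : Measure (Transcript Ω M t × M)) (r : Bool → N)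
    (f : Bool → Transcript Ω M t × M → ℝ≥0)
    (h : ∀ b, μ ⊗ₘ A.randomizer t (r b) = ρ.withDensity fun p => f b p) (v : Fin n → Bool) :
    μ ⊗ₘ A.answer (fun i => r (v i)) t
      = ρ.withDensity fun p => f (v (A.user t p.1)) p := by
  have hu : ∀ i, MeasurableSet {p : Transcript Ω M t × M | A.user t p.1 = i} := fun i =>
    ((A.measurable_user t).comp measurable_fst) (measurableSet_singleton i)
  ext s hs
  -- On the piece where individual `i` is queried, the answer kernel is the randomizer applied to
  -- the one record `r (v i)`.
  have hsplit : ∀ m : Measure (Transcript Ω M t × M),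
      m s = ∑ i, m (s ∩ {p | A.user t p.1 = i}) := by
    intro m
    rw [← measure_biUnion_finset]
    · congr 1
      ext p
      simp
    · intro i _ j _ hij
      refine Set.disjoint_left.2 fun p hp hp' => hij ?_
      exact hp.2.symm.trans hp'.2
    · exact fun i _ => hs.inter (hu i)
  rw [hsplit, hsplit (ρ.withDensity _)]
  refine Finset.sum_congr rfl fun i _ => ?_
  have hsi := hs.inter (hu i)
  have h1 : (μ ⊗ₘ A.answer (fun i => r (v i)) t) (s ∩ {p | A.user t p.1 = i})
      = (μ ⊗ₘ A.randomizer t (r (v i))) (s ∩ {p | A.user t p.1 = i}) := by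
    rw [Measure.compProd_apply hsi, Measure.compProd_apply hsi]
    refine lintegral_congr fun x => ?_
    by_cases hx : A.user t x = i
    · subst hx; rfl
    · simp [hx]
  rw [h1, h, withDensity_apply _ hsi, withDensity_apply _ hsi]
  refine setLIntegral_congr_fun hsi fun p hp => ?_
  have : A.user t p.1 = i := hp.2
  simp only [this]

theorem map_extend_withDensity (t : ℕ) (ρ : Measure (Transcript Ω M t × M))
    {g : Transcript Ω M t × M → ℝ≥0∞} (hg : Measurable g) :
    (ρ.withDensity g).map (extend Ω M t)
      = (ρ.map (extend Ω M t)).withDensity fun p => g (unextend Ω M t p) := by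
  ext s hs
  rw [Measure.map_apply (measurable_extend t) hs, withDensity_apply _ hs,
    withDensity_apply _ (measurable_extend t hs),
    setLIntegral_map (f := fun p => g (unextend Ω M t p)) hs
      (hg.comp (measurable_unextend t)) (measurable_extend t)]
  simp_rw [unextend_extend]

/-- The transcript laws of all databases over two records have densities which are products of
factors that depend on the record of one individual each. -/
theorem exists_transcriptLaw_eq_withDensity (A : LocalAlgorithm n N Ω M) (r : Bool → N) (t : ℕ) :
    ∃ (μ : Measure (Transcript Ω M t)) (F : Fin n → Bool → Transcript Ω M t → ℝ≥0),
      IsFiniteMeasure μ ∧ (∀ i b, Measurable (F i b)) ∧ ∀ v : Fin n → Bool,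
        A.transcriptLaw (fun i => r (v i)) t
          = μ.withDensity fun h => ((∏ i, F i (v i) h : ℝ≥0) : ℝ≥0∞) := by
  induction t with
  | zero =>
    refine ⟨A.coins.map fun ω => (ω, Fin.elim0), fun _ _ _ => 1, ?_, fun _ _ => measurable_const,
      fun v => ?_⟩
    · exact inferInstance
    · simp [transcriptLaw]
  | succ t ih =>
    obtain ⟨μ, F, hμ, hF, hlaw⟩ := ih
    set κ := A.randomizer t (r true) + A.randomizer t (r false) with hκ
    have hex : ∀ b, ∃ f : Transcript Ω M t × M → ℝ≥0, Measurable f ∧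
        μ ⊗ₘ A.randomizer t (r b) = (μ ⊗ₘ κ).withDensity fun p => f p := by
      intro b
      cases b
      · rw [hκ, add_comm]; exact exists_compProd_eq_withDensity _ _ _
      · exact exists_compProd_eq_withDensity _ _ _
    choose f hf hfκ using hex
    have hG : ∀ i b, Measurable fun p : Transcript Ω M t × M =>
        F i b p.1 * if A.user t p.1 = i then f b p else 1 := by
      intro i b
      refine ((hF i b).comp measurable_fst).mul (Measurable.ite ?_ (hf b) measurable_const)
      exact ((A.measurable_user t).comp measurable_fst) (measurableSet_singleton i)
    -- The density of the new answer is absorbed into the factor of the queried individual; all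
    -- other factors are unchanged.
    refine ⟨(μ ⊗ₘ κ).map (extend Ω M t), fun i b p => (fun q : Transcript Ω M t × M =>
        F i b q.1 * if A.user t q.1 = i then f b q else 1) (unextend Ω M t p),
      inferInstance, fun i b => (hG i b).comp (measurable_unextend t), fun v => ?_⟩
    have hprod : Measurable fun h => ∏ i, F i (v i) h :=
      Finset.measurable_prod _ fun i _ => hF i (v i)
    have hfv : Measurable fun p : Transcript Ω M t × M => f (v (A.user t p.1)) p := by
      have h1 : Measurable fun p : Fin n × (Transcript Ω M t × M) => f (v p.1) p.2 :=
        measurable_from_prod_countable_right fun i => hf (v i)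
      exact h1.comp (((A.measurable_user t).comp measurable_fst).prodMk measurable_id)
    have hprod' : Measurable fun p : Transcript Ω M t × M => ∏ i, F i (v i) p.1 :=
      hprod.comp measurable_fst
    rw [transcriptLaw, hlaw, compProd_withDensity_left _ _ hprod,
      A.compProd_answer t μ (μ ⊗ₘ κ) r f hfκ v,
      ← withDensity_mul _ hfv.coe_nnreal_ennreal hprod'.coe_nnreal_ennreal,
      map_extend_withDensity _ _ (hfv.coe_nnreal_ennreal.mul hprod'.coe_nnreal_ennreal)]
    congr 1
    funext p
    simp only [Pi.mul_apply, Finset.prod_mul_distrib, Finset.prod_ite_eq, Finset.mem_univ, if_true]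
    rw [← ENNReal.coe_mul, mul_comm]

/-- For uniformly random records the bits of the database are independent given the transcript:
`Q` is the law of the transcript and `θ i` is the posterior probability of bit `i`. -/
theorem exists_posterior (A : LocalAlgorithm n N Ω M) (r : Bool → N) (t : ℕ) :
    ∃ (Q : Measure (Transcript Ω M t)) (θ : Fin n → Transcript Ω M t → ℝ),
      IsProbabilityMeasure Q ∧ (∀ i, Measurable (θ i)) ∧ (∀ i h, 0 ≤ θ i h) ∧
      (∀ i h, θ i h ≤ 1) ∧ ∀ v : Fin n → Bool, A.transcriptLaw (fun i => r (v i)) t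
        = Q.withDensity fun h => ENNReal.ofReal (2 ^ n * bernProd (fun i => θ i h) v) := by
  obtain ⟨μ, F, hμ, hF, hlaw⟩ := A.exists_transcriptLaw_eq_withDensity r t
  -- Bayes' rule for a fair bit. If both factors vanish the quotient is `0` by convention, which is
  -- harmless: the density of `Q` vanishes there too.
  set θ : Fin n → Transcript Ω M t → ℝ :=
    fun i h => (F i true h : ℝ) / (F i true h + F i false h) with hθ
  have hθm : ∀ i, Measurable (θ i) := fun i => by
    have h1 := (hF i true).coe_nnreal_real
    have h2 := (hF i false).coe_nnreal_real
    exact h1.div (h1.add h2)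
  have h0 : ∀ i h, 0 ≤ θ i h := fun i h => by positivity
  have h1 : ∀ i h, θ i h ≤ 1 := fun i h =>
    div_le_one_of_le₀ (le_add_of_nonneg_right (NNReal.coe_nonneg _)) (by positivity)
  have hd : Measurable fun h => ∏ i, ((F i true h + F i false h) / 2) :=
    Finset.measurable_prod _ fun i _ => ((hF i true).add (hF i false)).div_const 2
  have hw : ∀ v : Fin n → Bool, Measurable fun h =>
      ENNReal.ofReal (2 ^ n * bernProd (fun i => θ i h) v) := fun v => by
    refine (Measurable.const_mul (Finset.measurable_prod _ fun i _ => ?_) _).ennreal_ofReal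
    cases v i
    · exact (hθm i).const_sub 1
    · exact hθm i
  have hlaw' : ∀ v : Fin n → Bool, A.transcriptLaw (fun i => r (v i)) t
      = (μ.withDensity fun h => ((∏ i, ((F i true h + F i false h) / 2) : ℝ≥0) : ℝ≥0∞)).withDensity
        fun h => ENNReal.ofReal (2 ^ n * bernProd (fun i => θ i h) v) := by
    intro v
    rw [hlaw, ← withDensity_mul _ hd.coe_nnreal_ennreal (hw v)]
    congr 1
    funext h
    rw [Pi.mul_apply, ← ENNReal.ofReal_coe_nnreal, ← ENNReal.ofReal_coe_nnreal,
      ← ENNReal.ofReal_mul (NNReal.coe_nonneg _)]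
    congr 1
    have h2 : (2 : ℝ) ^ n = ∏ _i : Fin n, 2 := by simp
    rw [bernProd, h2, ← Finset.prod_mul_distrib]
    push_cast
    rw [← Finset.prod_mul_distrib]
    refine Finset.prod_congr rfl fun i _ => ?_
    simp only [hθ]
    rcases eq_or_ne ((F i true h : ℝ) + F i false h) 0 with hz | hz
    · have ha : (F i true h : ℝ) = 0 := by
        linarith [(F i true h).coe_nonneg, (F i false h).coe_nonneg]
      have hb : (F i false h : ℝ) = 0 := by
        linarith [(F i true h).coe_nonneg, (F i false h).coe_nonneg]
      cases v i <;> simp [ha, hb]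
    · cases v i <;> simp only [bernWeight, cond_true, cond_false] <;> field_simp
      ring
  refine ⟨_, θ, ⟨?_⟩, hθm, h0, h1, hlaw'⟩
  set Q := μ.withDensity fun h => ((∏ i, ((F i true h + F i false h) / 2) : ℝ≥0) : ℝ≥0∞)
  -- `Q` is the average of the `2 ^ n` transcript laws, as the weights `bernProd` sum to one; hence
  -- it has mass one.
  have hsum : ∑ v : Fin n → Bool, A.transcriptLaw (fun i => r (v i)) t Set.univ
      = 2 ^ n * Q Set.univ := by
    simp_rw [hlaw', withDensity_apply _ MeasurableSet.univ, Measure.restrict_univ]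
    rw [← lintegral_finsetSum _ fun v _ => hw v]
    have : ∀ h, ∑ v : Fin n → Bool, ENNReal.ofReal (2 ^ n * bernProd (fun i => θ i h) v)
        = 2 ^ n := by
      intro h
      rw [← ENNReal.ofReal_sum_of_nonneg fun v _ => mul_nonneg (by positivity)
        (bernProd_nonneg (fun i => h0 i h) (fun i => h1 i h) v), ← Finset.mul_sum, sum_bernProd,
        mul_one, ENNReal.ofReal_pow (by norm_num), ENNReal.ofReal_ofNat]
    simp_rw [this]
    rw [lintegral_const]
  simp only [measure_univ, Finset.sum_const, Finset.card_univ, Fintype.card_pi, Fintype.card_bool,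
    Finset.prod_const, Fintype.card_fin, nsmul_eq_mul, mul_one] at hsum
  push_cast at hsum
  exact ((ENNReal.mul_right_inj (by simp) (by simp)).1 ((mul_one _).trans hsum)).symm

end LocalAlgorithm

/-! ### What privacy and the uniform prior imply for the posterior. -/

theorem sum_bernProd_update {n : ℕ} (θ : Fin n → ℝ) (i : Fin n) (b : Bool) :
    ∑ v, bernProd θ (Function.update v i b) = 2 * bernWeight (θ i) b := by
  have : ∀ v : Fin n → Bool, bernProd θ (Function.update v i b)
      = ∏ j, (fun j c => if j = i then bernWeight (θ i) b else bernWeight (θ j) c) j (v j) := by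
    intro v
    refine Finset.prod_congr rfl fun j _ => ?_
    by_cases h : j = i
    · subst h; simp
    · simp [h]
  simp_rw [this]
  rw [sum_prod_bool fun j c => if j = i then bernWeight (θ i) b else bernWeight (θ j) c]
  -- The frozen coordinate `i` is counted once for each of its two values, hence the factor `2`;
  -- every other coordinate sums to one.
  have : ∀ j, ((if j = i then bernWeight (θ i) b else bernWeight (θ j) true)
      + if j = i then bernWeight (θ i) b else bernWeight (θ j) false)
      = if j = i then 2 * bernWeight (θ i) b else 1 := by
    intro j
    split_ifs
    · ring
    · simp [bernWeight]
  simp_rw [this]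
  simp

section Posterior

variable {n : ℕ} {T : Type*} [MeasurableSpace T] {Q : Measure T} [IsProbabilityMeasure Q]
  {θ : Fin n → T → ℝ}

theorem measurable_bernWeight {p : T → ℝ} (hp : Measurable p) (b : Bool) :
    Measurable fun h => bernWeight (p h) b := by
  cases b
  · exact hp.const_sub 1
  · exact hp

theorem integrable_of_mem_Icc {f : T → ℝ} (hf : Measurable f) {a b : ℝ}
    (h : ∀ x, f x ∈ Set.Icc a b) : Integrable f Q :=
  Integrable.of_mem_Icc a b hf.aemeasurable (.of_forall h)

theorem integrable_bernWeight {p : T → ℝ} (hp : Measurable p) (h0 : ∀ x, 0 ≤ p x)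
    (h1 : ∀ x, p x ≤ 1) (b : Bool) : Integrable (fun h => bernWeight (p h) b) Q :=
  integrable_of_mem_Icc (measurable_bernWeight hp b) fun x =>
    ⟨bernWeight_nonneg (h0 x) (h1 x) b, bernWeight_le_one (h0 x) (h1 x) b⟩

theorem measurable_bernProd (hθ : ∀ i, Measurable (θ i)) (v : Fin n → Bool) :
    Measurable fun h => bernProd (fun i => θ i h) v :=
  Finset.measurable_prod _ fun i _ => measurable_bernWeight (hθ i) (v i)

theorem integrable_bernProd (hθ : ∀ i, Measurable (θ i)) (h0 : ∀ i h, 0 ≤ θ i h)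
    (h1 : ∀ i h, θ i h ≤ 1) (v : Fin n → Bool) :
    Integrable (fun h => bernProd (fun i => θ i h) v) Q :=
  integrable_of_mem_Icc (measurable_bernProd hθ v) fun h =>
    ⟨bernProd_nonneg (fun i => h0 i h) (fun i => h1 i h) v,
      bernProd_le_one (fun i => h0 i h) (fun i => h1 i h) v⟩

/-- If no event makes one value of a bit much more likely than the other, then the posterior
variance of this bit is bounded below. -/
theorem le_integral_variance {p : T → ℝ} (hp : Measurable p) (h0 : ∀ x, 0 ≤ p x)
    (h1 : ∀ x, p x ≤ 1) {δ : ℝ}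
    (h : ∀ (b : Bool) (S : Set T), MeasurableSet S →
      ∫ x in S, 2 * bernWeight (p x) b ∂Q ≤ 2 * (∫ x in S, 2 * bernWeight (p x) (!b) ∂Q) + δ)
    {η : ℝ} (hη : 0 < η) (hη1 : η ≤ 1 / 6) :
    η * (1 - η) * (1 - δ / (1 - 3 * η)) ≤ ∫ x, p x * (1 - p x) ∂Q := by
  -- `S b` collects the transcripts that nearly reveal the bit to be `b`. There the integrand `2 * w
  -- - 4 * (1 - w)`, with `w > 1 - η`, exceeds `2 - 6 * η`, so the hypothesis bounds the mass of `S
  -- b`.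
  set S : Bool → Set T := fun b => {x | 1 - η < bernWeight (p x) b} with hS
  have hSm : ∀ b, MeasurableSet (S b) := fun b =>
    measurableSet_lt measurable_const (measurable_bernWeight hp b)
  have hint : ∀ b, Integrable (fun x => 2 * bernWeight (p x) b) Q := fun b =>
    (integrable_bernWeight hp h0 h1 b).const_mul 2
  have hSQ : ∀ b, (1 - 3 * η) * (2 * Q.real (S b)) ≤ δ := by
    intro b
    have h2 := h b (S b) (hSm b)
    have h3 : ∫ _x in S b, (2 - 6 * η) ∂Q
        ≤ ∫ x in S b, (2 * bernWeight (p x) b - 2 * (2 * bernWeight (p x) (!b))) ∂Q := by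
      refine setIntegral_mono_on (integrable_const _).integrableOn
        ((hint b).sub ((hint !b).const_mul 2)).integrableOn (hSm b) fun x hx => ?_
      have hx' : 1 - η < bernWeight (p x) b := hx
      have : bernWeight (p x) (!b) = 1 - bernWeight (p x) b := by cases b <;> simp [bernWeight]
      linarith
    rw [integral_sub (hint b).integrableOn ((hint !b).const_mul 2).integrableOn,
      setIntegral_const, smul_eq_mul] at h3
    simp only [integral_const_mul] at h2 h3
    linarith
  -- Off both sets `p x` lies in `[η, 1 - η]`; on either of them the left side is nonpositive.
  have hpt : ∀ x, η * (1 - η) * (1 - (S true).indicator 1 x - (S false).indicator 1 x)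
      ≤ p x * (1 - p x) := by
    intro x
    have hpos : 0 ≤ p x * (1 - p x) := mul_nonneg (h0 x) (sub_nonneg.2 (h1 x))
    have hηpos : 0 ≤ η * (1 - η) := mul_nonneg hη.le (by linarith)
    by_cases ht : x ∈ S true
    · have : 0 ≤ (S false).indicator (1 : T → ℝ) x := Set.indicator_nonneg (by simp) x
      rw [Set.indicator_of_mem ht, Pi.one_apply]
      nlinarith
    by_cases hf : x ∈ S false
    · rw [Set.indicator_of_mem hf, Set.indicator_of_notMem ht, Pi.one_apply]
      linarith
    rw [Set.indicator_of_notMem ht, Set.indicator_of_notMem hf]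
    have ht' : p x ≤ 1 - η := not_lt.1 ht
    have hf' : 1 - p x ≤ 1 - η := not_lt.1 hf
    nlinarith
  have hI : ∀ b, Integrable ((S b).indicator (1 : T → ℝ)) Q := fun b =>
    (integrable_const (1 : ℝ)).indicator (hSm b)
  have hint2 : Integrable (fun x => p x * (1 - p x)) Q :=
    integrable_of_mem_Icc (a := 0) (b := 1) (hp.mul (hp.const_sub 1)) fun x =>
      ⟨mul_nonneg (h0 x) (sub_nonneg.2 (h1 x)), by nlinarith [h0 x, h1 x]⟩
  have hmono := integral_mono ((((integrable_const 1).sub (hI true)).sub (hI false)).const_mul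
    (η * (1 - η))) hint2 hpt
  refine le_trans ?_ hmono
  have he : ∫ x, (η * (1 - η)) * (((fun _ => (1 : ℝ)) - (S true).indicator 1
      - (S false).indicator 1 : T → ℝ) x) ∂Q
      = η * (1 - η) * (1 - Q.real (S true) - Q.real (S false)) := by
    rw [integral_const_mul, integral_sub' ((integrable_const 1).sub (hI true)) (hI false),
      integral_sub' (integrable_const 1) (hI true), integral_indicator_one (hSm _),
      integral_indicator_one (hSm _)]
    simp
  refine le_of_le_of_eq ?_ he.symm
  have h3η : 0 < 1 - 3 * η := by linarith
  refine mul_le_mul_of_nonneg_left ?_ (mul_nonneg hη.le (by linarith))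
  have hd : Q.real (S true) + Q.real (S false) ≤ δ / (1 - 3 * η) := by
    rw [le_div_iff₀ h3η]
    linarith [hSQ true, hSQ false]
  linarith

/-- The posterior mean of the number of ones is close to the prior mean. -/
theorem measureReal_mean_far_le (hn : 0 < n) (hθ : ∀ i, Measurable (θ i)) (h0 : ∀ i h, 0 ≤ θ i h)
    (h1 : ∀ i h, θ i h ≤ 1)
    (hQ : ∀ v, ∫ h, bernProd (fun i => θ i h) v ∂Q = bernProd (fun _ => 1 / 2) v)
    {σ : ℝ} (hσ : |σ| ≤ 1) (r : ℝ) :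
    Q.real {h | r * √n ≤ σ * (∑ i, θ i h - n / 2)} ≤ 2 * Real.exp (3 - r) := by
  set S := {h | r * √n ≤ σ * (∑ i, θ i h - n / 2)} with hS
  have hSm : MeasurableSet S := measurableSet_le measurable_const
    (((Finset.measurable_sum _ fun i _ => hθ i).sub_const _).const_mul σ)
  set B := Finset.univ.filter fun v : Fin n → Bool =>
    (r - 2) * √n ≤ σ * (trueCount v - ∑ _i : Fin n, (1 / 2 : ℝ)) with hB
  have hBle : ∑ v ∈ B, bernProd (fun _ => (1 / 2 : ℝ)) v ≤ Real.exp (3 - r) := by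
    have := bernProd_tail_le hn (θ := fun _ => 1 / 2) (fun _ => by norm_num)
      (fun _ => by norm_num) hσ (r - 2)
    rwa [show 1 - (r - 2) = 3 - r by ring] at this
  -- If the posterior mean is far from `n / 2`, then with posterior probability at least `1 / 2` so
  -- is the count, up to a loss of `2 * √n`. Averaged over transcripts, this is a tail event of the
  -- fair-coin prior.
  have hpt : ∀ h, S.indicator (fun _ => (1 / 2 : ℝ)) h
      ≤ ∑ v ∈ B, bernProd (fun i => θ i h) v := by
    intro h
    have hnn := bernProd_nonneg (fun i => h0 i h) (fun i => h1 i h)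
    by_cases hh : h ∈ S
    · rw [Set.indicator_of_mem hh]
      refine (half_le_bernProd_near_mean hn (fun i => h0 i h) (fun i => h1 i h)
        (σ := -σ) (by rwa [abs_neg])).trans ?_
      refine Finset.sum_le_sum_of_subset_of_nonneg (fun v hv => ?_) fun v _ _ => hnn v
      have hv' := (Finset.mem_filter.1 hv).2
      have hh' : r * √n ≤ σ * (∑ i, θ i h - n / 2) := hh
      rw [hB, Finset.mem_filter]
      refine ⟨Finset.mem_univ _, ?_⟩
      simp only [Finset.sum_const, Finset.card_univ, Fintype.card_fin, nsmul_eq_mul]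
      linarith
    · rw [Set.indicator_of_notMem hh]
      exact Finset.sum_nonneg fun v _ => hnn v
  have hmono := integral_mono ((integrable_const (μ := Q) (1 / 2 : ℝ)).indicator hSm)
    (integrable_finsetSum B fun v _ => integrable_bernProd hθ h0 h1 v) hpt
  rw [integral_indicator hSm, setIntegral_const, integral_finsetSum B fun v _ =>
    integrable_bernProd hθ h0 h1 v] at hmono
  simp_rw [hQ] at hmono
  rw [smul_eq_mul] at hmono
  linarith

/-- The posterior variance of the number of ones is large with positive probability. -/
theorem le_measureReal_variance_large (hn : 0 < n) (hθ : ∀ i, Measurable (θ i))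
    (h0 : ∀ i h, 0 ≤ θ i h) (h1 : ∀ i h, θ i h ≤ 1) {κ : ℝ} (hκ : 0 ≤ κ)
    (hvar : ∀ i, κ ≤ ∫ h, θ i h * (1 - θ i h) ∂Q) :
    2 * κ ≤ Q.real {h | κ * n / 2 ≤ ∑ i, θ i h * (1 - θ i h)} := by
  set S := {h | κ * n / 2 ≤ ∑ i, θ i h * (1 - θ i h)} with hS
  have hm : ∀ i, Measurable fun h => θ i h * (1 - θ i h) := fun i =>
    (hθ i).mul ((hθ i).const_sub 1)
  have hSm : MeasurableSet S :=
    measurableSet_le measurable_const (Finset.measurable_sum _ fun i _ => hm i)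
  have hint : ∀ i, Integrable (fun h => θ i h * (1 - θ i h)) Q := fun i =>
    integrable_of_mem_Icc (a := 0) (b := 1) (hm i) fun x =>
      ⟨mul_nonneg (h0 i x) (sub_nonneg.2 (h1 i x)), by nlinarith [h0 i x, h1 i x]⟩
  -- Reverse Markov inequality, using that the total variance never exceeds `n / 4`.
  have hpt : ∀ h, ∑ i, θ i h * (1 - θ i h)
      ≤ S.indicator (fun _ => (n / 4 : ℝ)) h + κ * n / 2 := by
    intro h
    by_cases hh : h ∈ S
    · rw [Set.indicator_of_mem hh]
      have : ∑ i, θ i h * (1 - θ i h) ≤ ∑ _i : Fin n, (1 / 4 : ℝ) :=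
        Finset.sum_le_sum fun i _ => by nlinarith [sq_nonneg (2 * θ i h - 1)]
      have h2 : (∑ _i : Fin n, (1 / 4 : ℝ)) = n / 4 := by simp; ring
      have h3 : 0 ≤ κ * n / 2 := by positivity
      linarith
    · rw [Set.indicator_of_notMem hh, zero_add]
      exact (not_le.1 hh).le
  have hI := (integrable_const (μ := Q) (n / 4 : ℝ)).indicator hSm
  have hmono := integral_mono (integrable_finsetSum Finset.univ fun i _ => hint i)
    (hI.add (integrable_const (κ * n / 2))) hpt
  have hr : ∫ h, (S.indicator (fun _ => (n / 4 : ℝ)) + fun _ => κ * n / 2 : T → ℝ) h ∂Q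
      = Q.real S * (n / 4) + κ * n / 2 := by
    rw [integral_add' hI (integrable_const _), integral_indicator hSm, setIntegral_const]
    simp
  have hmono' := hmono.trans_eq hr
  rw [integral_finsetSum _ fun i _ => hint i] at hmono'
  have hlow : (n : ℝ) * κ ≤ ∑ i, ∫ h, θ i h * (1 - θ i h) ∂Q := by
    have := Finset.sum_le_sum fun i (_ : i ∈ Finset.univ) => hvar i
    simpa using this
  have hn' : (0 : ℝ) < n := by exact_mod_cast hn
  have : n * (2 * κ) ≤ n * Q.real S := by linarith
  exact le_of_mul_le_mul_left this hn'

end Posterior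

/-! ### From two-sided tails to failure on a fixed transcript. -/

/-- A record held by more than half of the individuals is the only approximate heavy hitter. -/
theorem count_lt_fhh_sub {n : ℕ} {N : Type*} [Fintype N] [DecidableEq N] (v : Fin n → N)
    {y : N} {α : ℝ} (hα : 0 < α) (hy : (n : ℝ) / 2 + α ≤ count v y) {x : N} (hxy : x ≠ y) :
    (count v x : ℝ) < fhh v - α := by
  have h1 : count v y ≤ fhh v := Finset.le_sup (Finset.mem_univ y)
  have h2 : count v x + count v y ≤ n := by
    unfold count
    rw [← Finset.card_union_of_disjoint]
    · exact (Finset.card_le_univ _).trans_eq (Fintype.card_fin n)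
    · exact Finset.disjoint_filter.2 fun i _ hx hy => hxy (hx.symm.trans hy)
  have h1' : (count v y : ℝ) ≤ fhh v := by exact_mod_cast h1
  have h2' : (count v x : ℝ) + count v y ≤ n := by exact_mod_cast h2
  linarith

theorem count_comp_true {n : ℕ} {N : Type*} [DecidableEq N] {r : Bool → N}
    (hr : r true ≠ r false) (v : Fin n → Bool) :
    (count (fun i => r (v i)) (r true) : ℝ) = trueCount v := by
  rw [count, Finset.card_filter, trueCount]
  push_cast
  refine Finset.sum_congr rfl fun i _ => ?_
  cases v i <;> simp [hr.symm]

theorem count_comp_false {n : ℕ} {N : Type*} [DecidableEq N] {r : Bool → N}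
    (hr : r true ≠ r false) (v : Fin n → Bool) :
    (count (fun i => r (v i)) (r false) : ℝ) = n - trueCount v := by
  have hn : (n : ℝ) = ∑ _i : Fin n, 1 := by simp
  rw [count, Finset.card_filter, trueCount, hn, ← Finset.sum_sub_distrib]
  push_cast
  refine Finset.sum_congr rfl fun i _ => ?_
  cases v i <;> simp [hr]

section Density

variable {T : Type*} [MeasurableSpace T] {Q : Measure T}

theorem real_withDensity_ofReal {g : T → ℝ} (hg : Integrable g Q) (h0 : ∀ x, 0 ≤ g x)
    {S : Set T} (hS : MeasurableSet S) :
    (Q.withDensity fun x => ENNReal.ofReal (g x)).real S = ∫ x in S, g x ∂Q := by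
  rw [measureReal_def, withDensity_apply _ hS,
    ← ofReal_integral_eq_lintegral_ofReal hg.integrableOn (.of_forall h0),
    ENNReal.toReal_ofReal (integral_nonneg h0)]

theorem real_bind_withDensity_ofReal {N : Type*} [MeasurableSpace N] {g : T → ℝ}
    (hg : Measurable g) (h0 : ∀ x, 0 ≤ g x) (κ : Kernel T N)
    [IsMarkovKernel κ] {B : Set N} (hB : MeasurableSet B) :
    ((Q.withDensity fun x => ENNReal.ofReal (g x)).bind κ).real B
      = ∫ x, g x * (κ x).real B ∂Q := by
  have hκ : Measurable fun x => (κ x).real B := (κ.measurable_coe hB).ennreal_toReal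
  rw [measureReal_def, Measure.bind_apply hB κ.aemeasurable,
    lintegral_withDensity_eq_lintegral_mul _ hg.ennreal_ofReal (κ.measurable_coe hB),
    integral_eq_lintegral_of_nonneg_ae (.of_forall fun x => mul_nonneg (h0 x) measureReal_nonneg)
      (hg.mul hκ).aestronglyMeasurable]
  congr 1
  refine lintegral_congr fun x => ?_
  rw [Pi.mul_apply, ENNReal.ofReal_mul (h0 x), ofReal_measureReal]

end Density

/-- The average over all vectors of bits of the probability of failure is bounded below, if the
posterior variance of the number of ones is large and its posterior mean is near `n / 2`. -/
theorem le_sum_bernProd_mul_failure {n : ℕ} (hn : 0 < n) {N : Type*} [MeasurableSpace N]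
    [MeasurableSingletonClass N] {p q : N} (hpq : p ≠ q) (π : Measure N) [IsProbabilityMeasure π]
    {θ : Fin n → ℝ} (h0 : ∀ i, 0 ≤ θ i) (h1 : ∀ i, θ i ≤ 1) {κ K l : ℝ} (hl : 0 ≤ l)
    (hln : l ≤ √n) (hlK : K + 3 ≤ l * (κ / 2)) (hvar : κ * n / 2 ≤ ∑ i, θ i * (1 - θ i))
    (hmean : ∀ σ : ℝ, |σ| ≤ 1 → σ * (∑ i, θ i - n / 2) < K * √n)
    (fail : (Fin n → Bool) → Set N)
    (hp : ∀ v, trueCount v ≤ n / 2 - √n → {p}ᶜ ⊆ fail v)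
    (hq : ∀ v, n / 2 + √n ≤ trueCount v → {q}ᶜ ⊆ fail v) :
    Real.exp (-l ^ 2) / 4 ≤ ∑ v, bernProd θ v * π.real (fail v) := by
  have hs0 : 0 < √(n : ℝ) := Real.sqrt_pos.2 (by exact_mod_cast hn)
  have hsq : √(n : ℝ) * √n = n := Real.mul_self_sqrt (by positivity)
  have hW := bernProd_nonneg h0 h1
  -- The shift must pay for `K * √n` (offset of the posterior mean), `2 * √n` (slack in the tail
  -- bound) and `√n` (required margin).
  have hV : (K + 3) * √n ≤ l * (∑ i, θ i * (1 - θ i)) / √n := by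
    rw [le_div_iff₀ hs0, mul_assoc, hsq]
    calc _ ≤ l * (κ / 2) * n := by gcongr
      _ = l * (κ * n / 2) := by ring
      _ ≤ _ := by gcongr
  set B : ℝ → Finset (Fin n → Bool) := fun σ =>
    Finset.univ.filter fun v => σ * (trueCount v - n / 2) ≤ -√n with hB
  have htail : ∀ σ : ℝ, σ ^ 2 = 1 → Real.exp (-l ^ 2) / 4 ≤ ∑ v ∈ B σ, bernProd θ v := by
    intro σ hσ
    refine (le_bernProd_tail hn h0 h1 hσ hl hln).trans
      (Finset.sum_le_sum_of_subset_of_nonneg (fun v hv => ?_) fun v _ _ => hW v)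
    have hv' := (Finset.mem_filter.1 hv).2
    have hm := hmean σ ((sq_le_one_iff_abs_le_one σ).1 hσ.le)
    rw [hB, Finset.mem_filter]
    exact ⟨Finset.mem_univ _, by linarith⟩
  have hdisj : Disjoint (B 1) (B (-1)) := by
    rw [Finset.disjoint_left]
    intro v hv hv'
    have ha := (Finset.mem_filter.1 hv).2
    have hb := (Finset.mem_filter.1 hv').2
    linarith
  have hB1 : ∑ v ∈ B 1, bernProd θ v * π.real {p}ᶜ ≤ ∑ v ∈ B 1, bernProd θ v * π.real (fail v) :=
    Finset.sum_le_sum fun v hv => by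
      have hv' := (Finset.mem_filter.1 hv).2
      exact mul_le_mul_of_nonneg_left (measureReal_mono (hp v (by linarith))) (hW v)
  have hB2 : ∑ v ∈ B (-1), bernProd θ v * π.real {q}ᶜ
      ≤ ∑ v ∈ B (-1), bernProd θ v * π.real (fail v) :=
    Finset.sum_le_sum fun v hv => by
      have hv' := (Finset.mem_filter.1 hv).2
      exact mul_le_mul_of_nonneg_left (measureReal_mono (hq v (by linarith))) (hW v)
  rw [← Finset.sum_mul] at hB1 hB2
  -- No output equals both `p` and `q`. As `π` does not depend on `v`, its failures on the two
  -- disjoint tails add up.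
  have hun : 1 ≤ π.real {p}ᶜ + π.real {q}ᶜ := by
    have hu : ({p}ᶜ ∪ {q}ᶜ : Set N) = Set.univ := by
      ext x
      simp only [Set.mem_union, Set.mem_compl_iff, Set.mem_singleton_iff, Set.mem_univ, iff_true]
      by_contra! hx
      exact hpq (hx.1.symm.trans hx.2)
    calc (1 : ℝ) = π.real ({p}ᶜ ∪ {q}ᶜ) := by rw [hu, probReal_univ]
      _ ≤ _ := measureReal_union_le _ _
  have hβ : 0 ≤ Real.exp (-l ^ 2) / 4 := by positivity
  calc Real.exp (-l ^ 2) / 4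
      ≤ Real.exp (-l ^ 2) / 4 * π.real {p}ᶜ + Real.exp (-l ^ 2) / 4 * π.real {q}ᶜ := by
        rw [← mul_add]
        exact le_mul_of_one_le_right hβ hun
    _ ≤ ∑ v ∈ B 1, bernProd θ v * π.real (fail v)
        + ∑ v ∈ B (-1), bernProd θ v * π.real (fail v) :=
        add_le_add
          ((mul_le_mul_of_nonneg_right (htail 1 (by norm_num)) measureReal_nonneg).trans hB1)
          ((mul_le_mul_of_nonneg_right (htail (-1) (by norm_num)) measureReal_nonneg).trans hB2)
    _ = ∑ v ∈ B 1 ∪ B (-1), bernProd θ v * π.real (fail v) := (Finset.sum_union hdisj).symm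
    _ ≤ _ := Finset.sum_le_sum_of_subset_of_nonneg (Finset.subset_univ _) fun v _ _ =>
        mul_nonneg (hW v) measureReal_nonneg

/-! ### Averaging over databases and transcripts. -/

namespace LocalAlgorithm

variable {n : ℕ} {N Ω M : Type*} [MeasurableSpace N] [MeasurableSpace Ω] [MeasurableSpace M]

/-- Privacy bounds how much an event of the transcript can tell about one random bit. -/
theorem IsPrivate.setIntegral_bernWeight_le {A : LocalAlgorithm n N Ω M} {ε δ : ℝ}
    (hA : A.IsPrivate ε δ) (hε : ε ≤ 1 / 2) {r : Bool → N}
    {Q : Measure (Transcript Ω M A.rounds)} [IsProbabilityMeasure Q]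
    {θ : Fin n → Transcript Ω M A.rounds → ℝ} (hθ : ∀ i, Measurable (θ i))
    (h0 : ∀ i h, 0 ≤ θ i h) (h1 : ∀ i h, θ i h ≤ 1)
    (hlaw : ∀ v : Fin n → Bool, A.transcriptLaw (fun i => r (v i)) A.rounds
        = Q.withDensity fun h => ENNReal.ofReal (2 ^ n * bernProd (fun i => θ i h) v))
    (i : Fin n) (b : Bool) {S : Set (Transcript Ω M A.rounds)} (hS : MeasurableSet S) :
    ∫ h in S, 2 * bernWeight (θ i h) b ∂Q
      ≤ 2 * (∫ h in S, 2 * bernWeight (θ i h) (!b) ∂Q) + δ := by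
  have he : Real.exp ε ≤ 2 := by
    have h2 : Real.exp (1 / 2) ^ 2 = Real.exp 1 := by rw [← Real.exp_nat_mul]; norm_num
    have h3 : Real.exp ε ≤ Real.exp (1 / 2) := Real.exp_le_exp.2 hε
    nlinarith [Real.exp_one_lt_d9, Real.exp_pos (1 / 2)]
  have hupd : ∀ (v : Fin n → Bool) (c : Bool),
      (A.transcriptLaw (Function.update (fun i => r (v i)) i (r c)) A.rounds).real S
        = 2 ^ n * ∫ h in S, bernProd (fun i => θ i h) (Function.update v i c) ∂Q := by
    intro v c
    have : Function.update (fun i => r (v i)) i (r c) = fun j => r (Function.update v i c j) := by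
      funext j
      by_cases h : j = i
      · subst h; simp
      · simp [h]
    rw [this, hlaw, real_withDensity_ofReal ((integrable_bernProd hθ h0 h1 _).const_mul _)
      (fun h => mul_nonneg (by positivity)
        (bernProd_nonneg (fun i => h0 i h) (fun i => h1 i h) _)) hS, integral_const_mul]
  have hsum : ∀ c : Bool,
      ∑ v : Fin n → Bool, 2 ^ n * ∫ h in S, bernProd (fun i => θ i h) (Function.update v i c) ∂Q
        = 2 ^ n * ∫ h in S, 2 * bernWeight (θ i h) c ∂Q := by
    intro c
    rw [← Finset.mul_sum, ← integral_finsetSum _ fun v _ =>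
      (integrable_bernProd hθ h0 h1 _).integrableOn]
    simp_rw [sum_bernProd_update]
  have hle : ∀ v : Fin n → Bool,
      2 ^ n * ∫ h in S, bernProd (fun i => θ i h) (Function.update v i b) ∂Q
        ≤ 2 * (2 ^ n * ∫ h in S, bernProd (fun i => θ i h) (Function.update v i !b) ∂Q) + δ := by
    intro v
    rw [← hupd, ← hupd]
    refine (hA i (fun i => r (v i)) (r b) (r !b) S hS).trans ?_
    gcongr
  -- Summing over the records of the others turns the privacy inequality into one about the
  -- posterior of bit `i` alone.
  have htot := Finset.sum_le_sum fun v (_ : v ∈ Finset.univ) => hle v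
  rw [Finset.sum_add_distrib, ← Finset.mul_sum Finset.univ _ (2 : ℝ), hsum, hsum] at htot
  have hcard : ∑ _v : Fin n → Bool, δ = 2 ^ n * δ := by simp
  rw [hcard] at htot
  have h2n : (0 : ℝ) < 2 ^ n := by positivity
  refine le_of_mul_le_mul_left (htot.trans_eq ?_) h2n
  ring

/-- A private algorithm is not accurate, with explicit constants. -/
theorem IsPrivate.not_isAccurate [Fintype N] [DecidableEq N] [DiscreteMeasurableSpace N]
    [Nontrivial N] {A : LocalAlgorithm n N Ω M} {ε δ : ℝ}
    (hA : A.IsPrivate ε δ) (hε : ε ≤ 1 / 2) (hn : 0 < n) {η κ K l β : ℝ} (hη : 0 < η)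
    (hη1 : η ≤ 1 / 6) (hκ : 0 < κ) (hκη : κ ≤ η * (1 - η) * (1 - δ / (1 - 3 * η)))
    (hK : 4 * Real.exp (3 - K) ≤ κ) (hl : 0 ≤ l) (hln : l ≤ √n) (hlK : K + 3 ≤ l * (κ / 2))
    (hβ : β < Real.exp (-l ^ 2) / 4 * κ) : ¬ A.IsAccurate (√n) β := by
  intro hacc
  have hs0 : 0 < √(n : ℝ) := Real.sqrt_pos.2 (by exact_mod_cast hn)
  obtain ⟨p, q, hpq⟩ := exists_pair_ne N
  set r : Bool → N := fun b => bif b then q else p with hr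
  have hr' : r true ≠ r false := hpq.symm
  obtain ⟨Q, θ, hQ, hθ, h0, h1, hlaw⟩ := A.exists_posterior r A.rounds
  have hW0 : ∀ v h, 0 ≤ 2 ^ n * bernProd (fun i => θ i h) v := fun v h =>
    mul_nonneg (by positivity) (bernProd_nonneg (fun i => h0 i h) (fun i => h1 i h) v)
  have hWi : ∀ v, Integrable (fun h => 2 ^ n * bernProd (fun i => θ i h) v) Q := fun v =>
    (integrable_bernProd hθ h0 h1 v).const_mul _
  -- The posterior averages to the uniform prior, because each transcript law has mass one.
  have hprior : ∀ v, ∫ h, bernProd (fun i => θ i h) v ∂Q = bernProd (fun _ => 1 / 2) v := by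
    intro v
    have h2 := real_withDensity_ofReal (hWi v) (hW0 v) MeasurableSet.univ
    rw [← hlaw, probReal_univ, setIntegral_univ, integral_const_mul] at h2
    have h3 : bernProd (fun _ : Fin n => (1 / 2 : ℝ)) v = (1 / 2) ^ n := by
      have : ∀ b, bernWeight (1 / 2) b = 1 / 2 := by intro b; cases b <;> norm_num [bernWeight]
      simp only [bernProd, this, Finset.prod_const, Finset.card_univ, Fintype.card_fin]
    rw [h3, one_div, inv_pow]
    exact eq_inv_of_mul_eq_one_right h2.symm
  have hvar : ∀ i, κ ≤ ∫ h, θ i h * (1 - θ i h) ∂Q := fun i =>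
    hκη.trans (le_integral_variance (hθ i) (h0 i) (h1 i)
      (fun b S hS => hA.setIntegral_bernWeight_le hε hθ h0 h1 hlaw i b hS) hη hη1)
  have hV := le_measureReal_variance_large hn hθ h0 h1 hκ.le hvar
  have hup := measureReal_mean_far_le hn hθ h0 h1 hprior (σ := 1) (by norm_num) K
  have hdn := measureReal_mean_far_le hn hθ h0 h1 hprior (σ := -1) (by norm_num) K
  set SV := {h | κ * n / 2 ≤ ∑ i, θ i h * (1 - θ i h)}
  set S1 := {h | K * √n ≤ 1 * (∑ i, θ i h - n / 2)}
  set S2 := {h | K * √n ≤ -1 * (∑ i, θ i h - n / 2)}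
  have hsumm : Measurable fun h => ∑ i, θ i h - (n : ℝ) / 2 :=
    (Finset.measurable_sum _ fun i _ => hθ i).sub_const _
  have hGm : MeasurableSet (SV \ (S1 ∪ S2)) :=
    (measurableSet_le measurable_const
      (Finset.measurable_sum _ fun i _ => (hθ i).mul ((hθ i).const_sub 1))).diff
      ((measurableSet_le measurable_const (hsumm.const_mul _)).union
        (measurableSet_le measurable_const (hsumm.const_mul _)))
  -- The large-variance event has mass at least `2 * κ`; the two mean deviations remove at most `4 *
  -- exp (3 - K) ≤ κ`.
  have hG : κ ≤ Q.real (SV \ (S1 ∪ S2)) := by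
    have h2 : Q.real SV ≤ Q.real (SV \ (S1 ∪ S2)) + Q.real (S1 ∪ S2) :=
      (measureReal_mono (by rw [Set.sdiff_union_self]; exact Set.subset_union_left)).trans
        (measureReal_union_le _ _)
    have h3 := measureReal_union_le (μ := Q) S1 S2
    linarith
  set fail : (Fin n → Bool) → Set N := fun v =>
    {x | (fhh (fun i => r (v i)) : ℝ) - √n ≤ (count (fun i => r (v i)) x : ℝ)}ᶜ with hfail
  have hfm : ∀ v, MeasurableSet (fail v) := fun v => .of_discrete
  have hfp : ∀ v, trueCount v ≤ n / 2 - √n → {p}ᶜ ⊆ fail v := by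
    intro v hv x hx
    refine not_le.2 (count_lt_fhh_sub _ hs0 ?_ hx)
    have := count_comp_false hr' v
    simp only [hr, cond_false] at this ⊢
    rw [this]
    linarith
  have hfq : ∀ v, n / 2 + √n ≤ trueCount v → {q}ᶜ ⊆ fail v := by
    intro v hv x hx
    refine not_le.2 (count_lt_fhh_sub _ hs0 ?_ hx)
    have := count_comp_true hr' v
    simp only [hr, cond_true] at this ⊢
    rw [this]
    linarith
  have hout : ∀ v, (A.outputLaw fun i => r (v i)).real (fail v)
      = 2 ^ n * ∫ h, bernProd (fun i => θ i h) v * (A.output h).real (fail v) ∂Q := by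
    intro v
    rw [outputLaw, hlaw, real_bind_withDensity_ofReal ((measurable_bernProd hθ v).const_mul _)
      (hW0 v) _ (hfm v), ← integral_const_mul]
    simp_rw [mul_assoc]
  have hle : ∀ v, (A.outputLaw fun i => r (v i)).real (fail v) ≤ β := by
    intro v
    have : IsProbabilityMeasure (A.outputLaw fun i => r (v i)) := by
      unfold outputLaw; infer_instance
    have h2 := hacc fun i => r (v i)
    rw [hfail, probReal_compl_eq_one_sub .of_discrete]
    linarith
  have hint : ∀ v, Integrable
      (fun h => bernProd (fun i => θ i h) v * (A.output h).real (fail v)) Q := fun v =>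
    integrable_of_mem_Icc (a := 0) (b := 1) ((measurable_bernProd hθ v).mul
      (A.output.measurable_coe (hfm v)).ennreal_toReal) fun h =>
      ⟨mul_nonneg (bernProd_nonneg (fun i => h0 i h) (fun i => h1 i h) v) measureReal_nonneg,
        mul_le_one₀ (bernProd_le_one (fun i => h0 i h) (fun i => h1 i h) v) measureReal_nonneg
          measureReal_le_one⟩
  have hpt : ∀ h, (SV \ (S1 ∪ S2)).indicator (fun _ => Real.exp (-l ^ 2) / 4) h
      ≤ ∑ v, bernProd (fun i => θ i h) v * (A.output h).real (fail v) := by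
    intro h
    by_cases hh : h ∈ SV \ (S1 ∪ S2)
    · rw [Set.indicator_of_mem hh]
      obtain ⟨hhV, hhS⟩ := hh
      have ha : 1 * (∑ i, θ i h - n / 2) < K * √n := not_le.1 fun h' => hhS (.inl h')
      have hb : -1 * (∑ i, θ i h - n / 2) < K * √n := not_le.1 fun h' => hhS (.inr h')
      refine le_sum_bernProd_mul_failure hn hpq (A.output h) (fun i => h0 i h) (fun i => h1 i h)
        hl hln hlK hhV (fun σ hσ => ?_) fail hfp hfq
      refine (le_abs_self _).trans_lt ?_
      rw [abs_mul]
      refine (mul_le_of_le_one_left (abs_nonneg _) hσ).trans_lt (abs_lt.2 ⟨?_, ?_⟩) <;> linarith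
    · rw [Set.indicator_of_notMem hh]
      exact Finset.sum_nonneg fun v _ => mul_nonneg
        (bernProd_nonneg (fun i => h0 i h) (fun i => h1 i h) v) measureReal_nonneg
  have hmono := integral_mono ((integrable_const (μ := Q) (Real.exp (-l ^ 2) / 4)).indicator hGm)
    (integrable_finsetSum Finset.univ fun v _ => hint v) hpt
  rw [integral_indicator hGm, setIntegral_const, smul_eq_mul,
    integral_finsetSum _ fun v _ => hint v] at hmono
  -- Accuracy bounds the failure averaged over `v` by `β`, while the good transcripts force at least
  -- `κ * exp (-l ^ 2) / 4`.
  have htot := Finset.sum_le_sum fun v (_ : v ∈ Finset.univ) => (hout v).symm.trans_le (hle v)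
  rw [← Finset.mul_sum] at htot
  have hcard : ∑ _v : Fin n → Bool, β = 2 ^ n * β := by simp
  rw [hcard] at htot
  have h2n : (0 : ℝ) < 2 ^ n := by positivity
  have hfin := le_of_mul_le_mul_left htot h2n
  have hexp : 0 ≤ Real.exp (-l ^ 2) / 4 := by positivity
  have := mul_le_mul_of_nonneg_right hG hexp
  linarith

end LocalAlgorithm

end LocalPrivacy

/-! ### Choice of constants. -/

theorem mainTheorem1 (δ₀ : ℝ) (hδ₀ : δ₀ < 1) :
    ∃ c : ℝ, 0 < c ∧ ∃ β : ℝ, 0 < β ∧ ∃ n₀ : ℕ,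
      ∀ (ε δ : ℝ), ε ≤ 1 / 2 → δ ≤ δ₀ → ∀ n : ℕ, n₀ ≤ n →
        ∀ (N Ω M : Type*) [Fintype N] [DecidableEq N] [Nontrivial N]
          [MeasurableSpace N] [DiscreteMeasurableSpace N]
          [MeasurableSpace Ω] [MeasurableSpace M]
          (A : LocalPrivacy.LocalAlgorithm n N Ω M),
          A.IsPrivate ε δ → ¬ A.IsAccurate (c * Real.sqrt n) β := by
  obtain ⟨d, hd0, hd, hd1⟩ : ∃ d : ℝ, 0 ≤ d ∧ δ₀ ≤ d ∧ d < 1 :=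
    ⟨max δ₀ 0, le_max_right _ _, le_max_left _ _, max_lt hδ₀ one_pos⟩
  -- This makes `1 - 3 * η = (1 + d) / 2 > d`, so that `κ` is positive; `d ≥ 0` gives `η ≤ 1 / 6`.
  set η : ℝ := (1 - d) / 6 with hη
  have hη0 : 0 < η := by rw [hη]; linarith
  have hη1 : η ≤ 1 / 6 := by rw [hη]; linarith
  have h3η : 0 < 1 - 3 * η := by linarith
  set κ : ℝ := η * (1 - η) * (1 - d / (1 - 3 * η)) with hκ
  have hκ0 : 0 < κ := by
    have : d / (1 - 3 * η) < 1 := by rw [div_lt_one h3η, hη]; linarith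
    exact mul_pos (mul_pos hη0 (by linarith)) (by linarith)
  -- Solves `4 * exp (3 - K) = κ`.
  set K : ℝ := 3 - Real.log (κ / 4) with hK
  have hKexp : 4 * Real.exp (3 - K) ≤ κ := by
    rw [hK, sub_sub_cancel, Real.exp_log (by positivity)]
    linarith
  set l : ℝ := |K + 3| * (2 / κ) with hl
  have hl0 : 0 ≤ l := by positivity
  have hlK : K + 3 ≤ l * (κ / 2) := by
    have : l * (κ / 2) = |K + 3| := by rw [hl]; field_simp
    rw [this]
    exact le_abs_self _
  -- The margin is `√n` itself, so `c = 1`; the dependence on `δ₀` sits in `β` and `n₀`. The latter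
  -- ensures `l ≤ √n`, and the `+ 1` makes `n` positive.
  refine ⟨1, one_pos, Real.exp (-l ^ 2) / 4 * κ / 2, by positivity, ⌈l ^ 2⌉₊ + 1, ?_⟩
  intro ε δ hε hδ n hn N Ω M _ _ _ _ _ _ _ A hA
  have hn0 : 0 < n := by omega
  have hln : l ≤ √n := by
    refine Real.le_sqrt_of_sq_le ((Nat.le_ceil _).trans ?_)
    exact_mod_cast (by omega : ⌈l ^ 2⌉₊ ≤ n)
  have hβ : Real.exp (-l ^ 2) / 4 * κ / 2 < Real.exp (-l ^ 2) / 4 * κ :=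
    half_lt_self (by positivity)
  rw [one_mul]
  refine hA.not_isAccurate hε hn0 hη0 hη1 hκ0 ?_ hKexp hl0 hln hlK hβ
  rw [hκ]
  have : δ / (1 - 3 * η) ≤ d / (1 - 3 * η) := by
    gcongr
    exact hδ.trans hd
  exact mul_le_mul_of_nonneg_left (by linarith) (mul_nonneg hη0.le (by linarith))
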